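/- Let $\Gamma$ be a group acting on a Polish space $X$ by Borel automorphisms, i.e. for every $\gamma\in\Gamma$ the map $x\mapsto\gamma\cdot x$ is Borel. A *paradoxical decomposition* of the action is a partition of $X$ into finitely many (possibly empty) pieces $A_1,\dots,A_n,B_1,\dots,B_m$ for which there are group elements $\alpha_1,\dots,\alpha_n,\beta_1,\dots,\beta_m\in\Gamma$ such that the sets $\alpha_iA_i$ are pairwise disjoint, the sets $\beta_jB_j$ are pairwise disjoint, and $$X=\alpha_1A_1\cup\dots\cup\alpha_nA_n=\beta_1B_1\cup\dots\cup\beta_mB_m .$$ If the action has a paradoxical decomposition, then it has a paradoxical decomposition in which every piece $A_i$ and $B_j$ has the Baire property, i.e. differs from an open set by a meager set. -/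

import Mathlib

open scoped Pointwise

/-- The finite families `A` and `B` of subsets of `X` form a paradoxical decomposition of the action
of `Γ` on `X`: the sets `A 0, …, A (n - 1), B 0, …, B (m - 1)` partition `X`, and there are group
elements `α i` and `β j` such that the translates `α i • A i` partition `X` and the translates
`β j • B j` partition `X`. The pieces of the decomposition are the sets `A i` and `B j`; some of
them may be empty. -/
structure IsParadoxicalDecomposition (Γ : Type*) {X : Type*} [Group Γ] [MulAction Γ X] {n m : ℕ}
    (A : Fin n → Set X) (B : Fin m → Set X) : Prop where
  disjoint_left : ∀ i i', i ≠ i' → Disjoint (A i) (A i')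
  disjoint_right : ∀ j j', j ≠ j' → Disjoint (B j) (B j')
  disjoint_left_right : ∀ i j, Disjoint (A i) (B j)
  cover : (⋃ i, A i) ∪ (⋃ j, B j) = Set.univ
  exists_left : ∃ α : Fin n → Γ,
    (∀ i i', i ≠ i' → Disjoint (α i • A i) (α i' • A i')) ∧ (⋃ i, α i • A i) = Set.univ
  exists_right : ∃ β : Fin m → Γ,
    (∀ j j', j ≠ j' → Disjoint (β j • B j) (β j' • B j')) ∧ (⋃ j, β j • B j) = Set.univ

/-! A paradoxical decomposition is the same as a bijection from `X` to `X × Bool` moving each point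
by one of finitely many group elements, and a perfect matching of the bipartite graph `doublingMap`
on three copies of `X` yields such a bijection. The given decomposition supplies expansion:
iterating the inverse bijection shows that every finite `F` has at least `2 * F.card` neighbours. It
then suffices to find a Borel matching that is perfect off an invariant meagre set; on that set the
original bijection is kept, which does not affect the Baire property.

The matching is built in Borel stages, matched vertices being removed from the graph. Hall's theorem
makes no measurable choice, but it shows that each unmatched vertex has an edge whose removal
preserves Hall's condition (`HallOutside.exists_edge`). Doing this at all points of a sparse set at
once is harmless (`hall_and_expands_of_separated`): the neighbourhood of a small connected set meets
at most one new pair, and that of a large one loses only a small proportion. With separation `2 ^ (n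
+ 5)`, the expansion factor for large sets drops from `1 + 2⁻ⁿ` to `1 + 2⁻ⁿ⁻¹`, so the construction
runs through all stages.

Each stage can use any one of countably many sparse Borel sets covering the graph. A Baire category
argument (`exists_choice_isMeagre`) selects one per stage so that, over comeagrely many points,
every vertex in reach is caught. -/

section Combinatorics

/-! ### Walks in a graph given by finitely many maps. -/

variable {V I : Type*}

/-- The graph on `V` in which `v` is joined to each `e i v` is undirected, and `c` is a proper
two-colouring of it. -/
structure IsBipartiteFamily (e : I → V → V) (c : V → Bool) : Prop where
  symm : ∀ i v, ∃ j, e j (e i v) = v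
  side : ∀ i v, c (e i v) = !c v

/-- `w` is reached from `v` by a walk of length at most `k`. -/
def Near (e : I → V → V) (k : ℕ) (v w : V) : Prop :=
  ∃ l : List I, l.length ≤ k ∧ l.foldr e v = w

namespace Near

variable {e : I → V → V} {c : V → Bool}

theorem refl (k : ℕ) (v : V) : Near e k v v := ⟨[], by simp, rfl⟩

theorem single (i : I) (v : V) : Near e 1 v (e i v) := ⟨[i], by simp, rfl⟩

theorem mono {k k' : ℕ} (hk : k ≤ k') {v w : V} (h : Near e k v w) : Near e k' v w :=
  let ⟨l, hl, hw⟩ := h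
  ⟨l, hl.trans hk, hw⟩

theorem trans {k k' : ℕ} {u v w : V} (h : Near e k u v) (h' : Near e k' v w) :
    Near e (k + k') u w := by
  obtain ⟨l, hl, rfl⟩ := h
  obtain ⟨l', hl', rfl⟩ := h'
  -- `foldr` applies the last letter first, so the initial walk `l` stands on the right.
  exact ⟨l' ++ l, by simp; omega, by simp⟩

theorem symm (h : IsBipartiteFamily e c) {k : ℕ} {v w : V} (hvw : Near e k v w) :
    Near e k w v := by
  obtain ⟨l, hl, rfl⟩ := hvw
  refine mono hl ?_
  clear hl
  induction l with
  | nil => exact refl _ _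
  | cons i l ih =>
    obtain ⟨j, hj⟩ := h.symm i (l.foldr e v)
    have h1 := single (e := e) j (e i (l.foldr e v))
    rw [hj] at h1
    simpa [add_comm] using h1.trans ih

end Near

/-! ### Hall's condition and linked sets. -/

open Classical in
/-- The neighbours of the elements of `F` that lie outside `D`. -/
noncomputable def outNbhd [Fintype I] (e : I → V → V) (D : Set V) (F : Finset V) : Finset V :=
  (F.biUnion fun v => Finset.univ.image fun i => e i v).filter (· ∉ D)

theorem mem_outNbhd [Fintype I] {e : I → V → V} {D : Set V} {F : Finset V} {w : V} :
    w ∈ outNbhd e D F ↔ (∃ v ∈ F, ∃ i, e i v = w) ∧ w ∉ D := by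
  simp [outNbhd]

/-- Hall's condition for the graph with the vertices in `D` removed. -/
def HallOutside [Fintype I] (e : I → V → V) (D : Set V) : Prop :=
  ∀ F : Finset V, (∀ v ∈ F, v ∉ D) → F.card ≤ (outNbhd e D F).card

/-- `F` is connected for the relation of having a common neighbour. -/
def Linked (e : I → V → V) (F : Finset V) : Prop :=
  ∀ S ⊆ F, S.Nonempty → S ≠ F → ∃ v ∈ S, ∃ w ∈ F, w ∉ S ∧ ∃ i j, e i v = e j w

/-- Large linked sets expand by a factor `1 + 2⁻ⁿ` in the graph with `D` removed. -/
def ExpandsOutside [Fintype I] (e : I → V → V) (n : ℕ) (D : Set V) : Prop :=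
  ∀ F : Finset V, Linked e F → (∀ v ∈ F, v ∉ D) → 2 ^ (n + 1) ≤ F.card →
    (2 ^ n + 1) * F.card ≤ 2 ^ n * (outNbhd e D F).card

variable {e : I → V → V} {c : V → Bool}

/-- A set that is not linked splits into two parts with disjoint neighbourhoods, and Hall's
inequalities for the parts add up. -/
theorem hallOutside_of_linked [Fintype I] {D : Set V}
    (h : ∀ F : Finset V, Linked e F → (∀ v ∈ F, v ∉ D) → F.card ≤ (outNbhd e D F).card) :
    HallOutside e D := by
  classical
  intro F
  induction F using Finset.strongInduction with
  | H F ih =>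
    intro hF
    by_cases hl : Linked e F
    · exact h F hl hF
    simp only [Linked, not_forall] at hl
    obtain ⟨S, hSF, hSne, hS, hno⟩ := hl
    push Not at hno
    have hSF' : S ⊂ F := Finset.ssubset_iff_subset_ne.2 ⟨hSF, hS⟩
    have h1 := ih S hSF' fun v hv => hF v (hSF hv)
    have h2 := ih (F \ S) (Finset.sdiff_ssubset hSF hSne)
      fun v hv => hF v (Finset.mem_sdiff.1 hv).1
    have hcard : (F \ S).card + S.card = F.card := Finset.card_sdiff_add_card_eq_card hSF
    have hdisj : Disjoint (outNbhd e D S) (outNbhd e D (F \ S)) := by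
      rw [Finset.disjoint_left]
      intro y hy hy'
      obtain ⟨v, hv, i, rfl⟩ := (mem_outNbhd.1 hy).1
      obtain ⟨w, hw, j, hj⟩ := (mem_outNbhd.1 hy').1
      rw [Finset.mem_sdiff] at hw
      exact hno v hv w hw.1 hw.2 i j hj.symm
    have hsub : outNbhd e D S ∪ outNbhd e D (F \ S) ⊆ outNbhd e D F := by
      intro y
      simp only [Finset.mem_union, mem_outNbhd, Finset.mem_sdiff]
      rintro (⟨⟨v, hv, i, rfl⟩, hy⟩ | ⟨⟨v, hv, i, rfl⟩, hy⟩)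
      · exact ⟨⟨v, hSF hv, i, rfl⟩, hy⟩
      · exact ⟨⟨v, hv.1, i, rfl⟩, hy⟩
    have := Finset.card_le_card hsub
    rw [Finset.card_union_of_disjoint hdisj] at this
    omega

open Classical in
/-- The elements of `F` reached from `w` in `k` steps between elements with a common neighbour. -/
noncomputable def linkBall (e : I → V → V) (F : Finset V) (w : V) : ℕ → Finset V
  | 0 => {w}
  | k + 1 => F.filter fun u => u ∈ linkBall e F w k ∨ ∃ v ∈ linkBall e F w k, ∃ i j, e i v = e j u

theorem mem_linkBall_succ {F : Finset V} {w u : V} {k : ℕ} :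
    u ∈ linkBall e F w (k + 1) ↔ u ∈ F ∧
      (u ∈ linkBall e F w k ∨ ∃ v ∈ linkBall e F w k, ∃ i j, e i v = e j u) := by
  simp [linkBall]

theorem linkBall_subset {F : Finset V} {w : V} (hw : w ∈ F) (k : ℕ) : linkBall e F w k ⊆ F := by
  cases k with
  | zero => simpa [linkBall] using hw
  | succ k => exact fun u hu => (mem_linkBall_succ.1 hu).1

theorem near_of_mem_linkBall (h : IsBipartiteFamily e c) {F : Finset V} {w : V} {k : ℕ} {u : V}
    (hu : u ∈ linkBall e F w k) : Near e (2 * k) w u := by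
  induction k generalizing u with
  | zero =>
    obtain rfl : u = w := by simpa [linkBall] using hu
    exact Near.refl _ _
  | succ k ih =>
    rcases (mem_linkBall_succ.1 hu).2 with hu | ⟨v, hv, i, j, hij⟩
    · exact (ih hu).mono (by omega)
    · have h1 := (Near.single (e := e) j u).symm h
      rw [← hij] at h1
      exact (((ih hv).trans (Near.single i v)).trans h1).mono (by omega)

/-- By linkedness the ball gains a point at each step until it exhausts `F`. This bounds the
diameter of linked sets and gives the packing bound for large ones. -/
theorem le_card_linkBall {F : Finset V} (hF : Linked e F) {w : V} (hw : w ∈ F) (k : ℕ) :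
    min F.card (k + 1) ≤ (linkBall e F w k).card := by
  induction k with
  | zero => simp [linkBall]
  | succ k ih =>
    have hsub : linkBall e F w k ⊆ linkBall e F w (k + 1) := fun u hu =>
      mem_linkBall_succ.2 ⟨linkBall_subset hw k hu, Or.inl hu⟩
    by_cases heq : linkBall e F w k = F
    · rw [heq] at hsub
      exact (min_le_left _ _).trans (Finset.card_le_card hsub)
    have hne : (linkBall e F w k).Nonempty := by
      rw [← Finset.card_pos]
      have := Finset.card_pos.2 ⟨w, hw⟩
      omega
    obtain ⟨v, hv, u, hu, huS, i, j, hij⟩ := hF _ (linkBall_subset hw k) hne heq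
    have : linkBall e F w k ⊂ linkBall e F w (k + 1) :=
      Finset.ssubset_iff_of_subset hsub |>.2
        ⟨u, mem_linkBall_succ.2 ⟨hu, Or.inr ⟨v, hv, i, j, hij⟩⟩, huS⟩
    have := Finset.card_lt_card this
    omega

theorem Linked.near (h : IsBipartiteFamily e c) {F : Finset V} (hF : Linked e F) {u v : V}
    (hu : u ∈ F) (hv : v ∈ F) : Near e (2 * F.card) u v := by
  have hball : linkBall e F u F.card = F := by
    refine Finset.eq_of_subset_of_card_le (linkBall_subset hu _) ?_
    have := le_card_linkBall hF hu F.card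
    omega
  exact near_of_mem_linkBall h (hball.symm ▸ hv : v ∈ linkBall e F u F.card)

/-- Hall's theorem gives injections along edges from each side into the other; a Schröder–Bernstein
argument that stays on edges merges them into a perfect matching. -/
theorem HallOutside.exists_matching [Fintype I] (h : IsBipartiteFamily e c) {D : Set V}
    (hD : HallOutside e D) :
    ∃ p : V → V, ∀ v, v ∉ D → p v ∉ D ∧ p (p v) = v ∧ ∃ i, e i v = p v := by
  classical
  obtain ⟨f, hf, hft⟩ := (Finset.all_card_le_biUnion_card_iff_exists_injective
    (fun v : {v // v ∉ D} => outNbhd e D {v.1})).1 (by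
      intro s
      have := hD (s.map (Function.Embedding.subtype _)) (fun v hv => by
        obtain ⟨v, _, rfl⟩ := Finset.mem_map.1 hv
        exact v.2)
      rw [Finset.card_map] at this
      refine this.trans (Finset.card_le_card ?_)
      intro y
      simp only [mem_outNbhd, Finset.mem_biUnion]
      rintro ⟨⟨v, hv, i, rfl⟩, hy⟩
      obtain ⟨v, hvs, rfl⟩ := Finset.mem_map.1 hv
      exact ⟨v, hvs, ⟨v, by simp, i, rfl⟩, hy⟩)
  have hf1 : ∀ v, f v ∉ D := fun v => (mem_outNbhd.1 (hft v)).2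
  have hf2 : ∀ v : {v // v ∉ D}, ∃ i, e i v = f v := fun v => by
    simpa using (mem_outNbhd.1 (hft v)).1
  let L := {v // v ∉ D ∧ c v = true}
  let R := {v // v ∉ D ∧ c v = false}
  let fL : L → R := fun v => ⟨f ⟨v.1, v.2.1⟩, hf1 _, by
    obtain ⟨i, hi⟩ := hf2 ⟨v.1, v.2.1⟩
    rw [← hi, h.side, v.2.2]; rfl⟩
  let fR : R → L := fun v => ⟨f ⟨v.1, v.2.1⟩, hf1 _, by
    obtain ⟨i, hi⟩ := hf2 ⟨v.1, v.2.1⟩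
    rw [← hi, h.side, v.2.2]; rfl⟩
  have hfL : Function.Injective fL := fun v w hvw => by
    have := hf (a₁ := ⟨v.1, v.2.1⟩) (a₂ := ⟨w.1, w.2.1⟩) (congrArg Subtype.val hvw)
    exact Subtype.ext (congrArg (fun z : {v // v ∉ D} => z.1) this)
  have hfR : Function.Injective fR := fun v w hvw => by
    have := hf (a₁ := ⟨v.1, v.2.1⟩) (a₂ := ⟨w.1, w.2.1⟩) (congrArg Subtype.val hvw)
    exact Subtype.ext (congrArg (fun z : {v // v ∉ D} => z.1) this)
  obtain ⟨g, hg, hgr⟩ := Function.Embedding.schroeder_bernstein_of_rel hfL hfR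
    (fun v w => ∃ i, e i v.1 = w.1) (fun v => hf2 ⟨v.1, v.2.1⟩) (fun w => by
      obtain ⟨i, hi⟩ := hf2 ⟨w.1, w.2.1⟩
      obtain ⟨j, hj⟩ := h.symm i w.1
      exact ⟨j, by rw [← hj, hi]⟩)
  let E := Equiv.ofBijective g hg
  refine ⟨fun v => if hv : v ∉ D then
    (if hc : c v = true then (E ⟨v, hv, hc⟩).1
      else (E.symm ⟨v, hv, by simpa using hc⟩).1) else v, fun v hv => ?_⟩
  simp only [dif_pos hv]
  by_cases hc : c v = true
  · simp only [dif_pos hc]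
    have hE := (E ⟨v, hv, hc⟩).2
    refine ⟨hE.1, ?_, hgr ⟨v, hv, hc⟩⟩
    rw [dif_pos hE.1, dif_neg (by simp [hE.2])]
    simp
  · simp only [dif_neg hc]
    have hc' : c v = false := by simpa using hc
    have hE := (E.symm ⟨v, hv, hc'⟩).2
    refine ⟨hE.1, ?_, ?_⟩
    · rw [dif_pos hE.1, dif_pos hE.2]
      simp
    · obtain ⟨i, hi⟩ := hgr (E.symm ⟨v, hv, hc'⟩)
      have h2 : g (E.symm ⟨v, hv, hc'⟩) = ⟨v, hv, hc'⟩ := E.apply_symm_apply _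
      rw [h2] at hi
      obtain ⟨j, hj⟩ := h.symm i (E.symm ⟨v, hv, hc'⟩).1
      rw [hi] at hj
      exact ⟨j, hj⟩

/-- Match `x` to its partner in a perfect matching: the rest of that matching witnesses Hall's
condition for what remains. -/
theorem HallOutside.exists_edge [Fintype I] (h : IsBipartiteFamily e c) {D : Set V} (hD : HallOutside e D)
    {x : V} (hx : x ∉ D) : ∃ i, e i x ∉ D ∧ HallOutside e (D ∪ {x, e i x}) := by
  classical
  obtain ⟨p, hp⟩ := hD.exists_matching h
  obtain ⟨hpx, hppx, i, hi⟩ := hp x hx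
  refine ⟨i, hi ▸ hpx, fun F hF => ?_⟩
  rw [hi] at hF ⊢
  have hF' : ∀ v ∈ F, v ∉ D ∧ v ≠ x ∧ v ≠ p x := fun v hv => by
    have := hF v hv
    simp at this
    tauto
  have hinj : Set.InjOn p F := fun v hv w hw hvw => by
    rw [← (hp v (hF' v hv).1).2.1, ← (hp w (hF' w hw).1).2.1, hvw]
  rw [← Finset.card_image_of_injOn hinj]
  refine Finset.card_le_card fun y hy => ?_
  obtain ⟨v, hv, rfl⟩ := Finset.mem_image.1 hy
  obtain ⟨h1, h2, j, hj⟩ := hp v (hF' v hv).1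
  refine mem_outNbhd.2 ⟨⟨v, hv, j, hj⟩, ?_⟩
  simp only [Set.mem_union, Set.mem_insert_iff, Set.mem_singleton_iff, not_or]
  refine ⟨h1, fun h3 => ?_, fun h3 => ?_⟩
  · rw [h3] at h2; exact (hF' v hv).2.2 h2.symm
  · rw [h3, hppx] at h2; exact (hF' v hv).2.1 h2.symm

theorem card_outNbhd_mono [Fintype I] {D D' : Set V} {F : Finset V} (h : ∀ v ∈ F, ∀ i, e i v ∈ D' → e i v ∈ D) :
    (outNbhd e D F).card ≤ (outNbhd e D' F).card := by
  refine Finset.card_le_card fun y hy => ?_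
  rw [mem_outNbhd] at hy ⊢
  obtain ⟨⟨v, hv, i, rfl⟩, hy⟩ := hy
  exact ⟨⟨v, hv, i, rfl⟩, fun h' => hy (h v hv i h')⟩

open Classical in
/-- Once Hall's condition holds, removing an edge at `x` can only violate it inside the connected
component of `x`. -/
theorem hallOutside_union_pair_iff [Fintype I] (h : IsBipartiteFamily e c) {D : Set V} (hD : HallOutside e D)
    (x : V) (i : I) : HallOutside e (D ∪ {x, e i x}) ↔ ∀ J : Finset (List I),
      (∀ l ∈ J, l.foldr e x ∉ D ∪ {x, e i x}) →
      (J.image fun l => l.foldr e x).card ≤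
        (outNbhd e (D ∪ {x, e i x}) (J.image fun l => l.foldr e x)).card := by
  constructor
  · intro hH J hJ
    refine hH _ fun v hv => ?_
    obtain ⟨l, hl, rfl⟩ := Finset.mem_image.1 hv
    exact hJ l hl
  · intro hJ
    refine hallOutside_of_linked fun F hF hFD => ?_
    have hFD0 : ∀ v ∈ F, v ∉ D := fun v hv hvD => hFD v hv (Or.inl hvD)
    -- If `F` has a neighbour in the removed pair, linkedness makes all of `F` reachable from `x`,
    -- so `F` is named by words; otherwise its neighbourhood outside `D` is unchanged.
    by_cases hx : ∃ v ∈ F, ∃ j, e j v = x ∨ e j v = e i x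
    · obtain ⟨u, hu, j, hj⟩ := hx
      have hxu : Near e 2 x u := by
        have h1 := (Near.single (e := e) j u).symm h
        rcases hj with hj | hj
        · rw [hj] at h1; exact h1.mono (by omega)
        · rw [hj] at h1; exact (Near.single (e := e) i x).trans h1
      have hall : ∀ v ∈ F, ∃ l : List I, l.foldr e x = v := fun v hv => by
        obtain ⟨l, -, hl⟩ := hxu.trans (hF.near h hu hv)
        exact ⟨l, hl⟩
      choose! w hw using hall
      have himage : ((F.image w).image fun l => l.foldr e x) = F := by
        rw [Finset.image_image]
        conv_rhs => rw [← Finset.image_id (s := F)]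
        exact Finset.image_congr fun v hv => hw v hv
      have := hJ (F.image w) fun l hl => by
        obtain ⟨v, hv, rfl⟩ := Finset.mem_image.1 hl
        rw [hw v hv]
        exact hFD v hv
      rwa [himage] at this
    · push Not at hx
      refine (hD F hFD0).trans (card_outNbhd_mono fun v hv j hvj => ?_)
      rcases hvj with hvj | hvj | hvj
      · exact hvj
      · exact absurd hvj (hx v hv j).1
      · exact absurd hvj (hx v hv j).2

/-! ### Removing a sparse family of pairs. -/

/-- The threshold `2 ^ (n + 2)` separates two regimes: below it only one pair matters and `hsD`
applies; above it the density of pairs near `F` is at most `2⁻ⁿ⁻²`, so the expansion absorbs the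
loss. -/
theorem hall_and_expands_of_separated [Fintype I] (h : IsBipartiteFamily e c) {n : ℕ} {D U : Set V}
    {s : V → V} (hD : HallOutside e D) (hE : ExpandsOutside e n D)
    (hs : ∀ x ∈ U, ∃ i, e i x = s x)
    (hsD : ∀ x ∈ U, HallOutside e (D ∪ {x, s x}))
    (hsep : ∀ x ∈ U, ∀ y ∈ U, Near e (2 ^ (n + 5)) x y → x = y) :
    HallOutside e (D ∪ U ∪ s '' U) ∧ ExpandsOutside e (n + 1) (D ∪ U ∪ s '' U) := by
  classical
  set D' := D ∪ U ∪ s '' U with hD'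
  have hτ : ∀ y, y ∈ D' → y ∉ D → ∃ x ∈ U, y = x ∨ y = s x := by
    rintro y ((hy | hy) | ⟨x, hx, rfl⟩) hyD
    · exact absurd hy hyD
    · exact ⟨y, hy, Or.inl rfl⟩
    · exact ⟨x, hx, Or.inr rfl⟩
  choose! τ hτU hτ using hτ
  -- `T` indexes the new pairs that meet the neighbourhood of `F`; each index is within distance 2
  -- of `F`.
  have key : ∀ F : Finset V, Linked e F → (∀ v ∈ F, v ∉ D') → ∃ T : Finset V,
      (∀ x ∈ T, x ∈ U ∧ ∃ u ∈ F, Near e 2 x u) ∧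
      ∀ y ∈ outNbhd e D F, y ∈ D' → ∃ x ∈ T, y = x ∨ y = s x := by
    intro F _ _
    refine ⟨((outNbhd e D F).filter (· ∈ D')).image τ, ?_, fun y hy hy' =>
      ⟨τ y, Finset.mem_image_of_mem _ (Finset.mem_filter.2 ⟨hy, hy'⟩),
        hτ y hy' (mem_outNbhd.1 hy).2⟩⟩
    intro x hx
    obtain ⟨y, hy, rfl⟩ := Finset.mem_image.1 hx
    obtain ⟨hyN, hy'⟩ := Finset.mem_filter.1 hy
    obtain ⟨⟨u, hu, i, hi⟩, hyD⟩ := mem_outNbhd.1 hyN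
    refine ⟨hτU y hy' hyD, ?_⟩
    have h1 := (Near.single (e := e) i u).symm h
    rw [hi] at h1
    refine ⟨u, hu, ?_⟩
    rcases hτ y hy' hyD with h2 | h2
    · rw [← h2]; exact h1.mono (by omega)
    · obtain ⟨j, hj⟩ := hs _ (hτU y hy' hyD)
      have h3 := Near.single (e := e) j (τ y)
      rw [hj, ← h2] at h3
      exact h3.trans h1
  have hp : 1 ≤ 2 ^ n := Nat.one_le_two_pow
  have hsmall : ∀ F : Finset V, Linked e F → (∀ v ∈ F, v ∉ D') → F.card < 2 ^ (n + 2) →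
      F.card ≤ (outNbhd e D' F).card := by
    intro F hF hFD hlt
    obtain ⟨T, hT, hTD⟩ := key F hF hFD
    have hFD0 : ∀ v ∈ F, v ∉ D := fun v hv hvD => hFD v hv (Or.inl (Or.inl hvD))
    rcases T.eq_empty_or_nonempty with rfl | ⟨x, hx⟩
    · refine (hD F hFD0).trans (card_outNbhd_mono fun v hv i hy' => ?_)
      by_contra hyD
      simpa using hTD _ (mem_outNbhd.2 ⟨⟨v, hv, i, rfl⟩, hyD⟩) hy'
    · obtain ⟨hxU, u, hu, hxu⟩ := hT x hx
      refine (hsD x hxU F fun v hv hv' => hFD v hv ?_).trans (card_outNbhd_mono fun v hv i hy' => ?_)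
      · rcases hv' with hv' | rfl | rfl
        · exact Or.inl (Or.inl hv')
        · exact Or.inl (Or.inr hxU)
        · exact Or.inr ⟨x, hxU, rfl⟩
      · by_cases hyD : e i v ∈ D
        · exact Or.inl hyD
        obtain ⟨x', hx', hyx'⟩ := hTD _ (mem_outNbhd.2 ⟨⟨v, hv, i, rfl⟩, hyD⟩) hy'
        obtain ⟨hxU', u', hu', hxu'⟩ := hT x' hx'
        have huu' := hF.near h hu hu'
        -- Two indices would be at distance at most `2 + 2 * F.card + 2`, which is below the
        -- separation.
        have : x = x' := hsep x hxU x' hxU' <|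
          ((hxu.trans huu').trans (hxu'.symm h)).mono (by
            rw [pow_add] at hlt ⊢; omega)
        subst this
        exact Or.inr hyx'
  have hlarge : ∀ F : Finset V, Linked e F → (∀ v ∈ F, v ∉ D') → 2 ^ (n + 2) ≤ F.card →
      (2 ^ (n + 1) + 1) * F.card ≤ 2 ^ (n + 1) * (outNbhd e D' F).card := by
    intro F hF hFD hle
    obtain ⟨T, hT, hTD⟩ := key F hF hFD
    have hFD0 : ∀ v ∈ F, v ∉ D := fun v hv hvD => hFD v hv (Or.inl (Or.inl hvD))
    have h1 := hE F hF hFD0 (le_trans (Nat.pow_le_pow_right (by omega) (by omega)) hle)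
    have h2 : (outNbhd e D F).card ≤ (outNbhd e D' F).card + T.card * 2 := by
      have hsub : outNbhd e D F ⊆ outNbhd e D' F ∪ T.biUnion fun x => {x, s x} := by
        intro y hy
        by_cases hy' : y ∈ D'
        · obtain ⟨x, hx, hxy⟩ := hTD y hy hy'
          exact Finset.mem_union_right _ (Finset.mem_biUnion.2 ⟨x, hx, by simpa using hxy⟩)
        · exact Finset.mem_union_left _ (mem_outNbhd.2 ⟨(mem_outNbhd.1 hy).1, hy'⟩)
      have h3 := (Finset.card_le_card hsub).trans (Finset.card_union_le _ _)
      have h4 := Finset.card_biUnion_le_card_mul T (fun x => ({x, s x} : Finset V)) 2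
        fun x _ => Finset.card_le_two
      omega
    -- Packing: link balls of radius `2 ^ (n + 2)` attached to distinct indices are disjoint, since
    -- a common point would put the indices within `2 ^ (n + 4) + 4 ≤ 2 ^ (n + 5)`. Each ball has at
    -- least `2 ^ (n + 2)` elements.
    have h3 : T.card * 2 ^ (n + 2) ≤ F.card := by
      choose! g hgF hg using fun x hx => (hT x hx).2
      have hdisj : (T : Set V).PairwiseDisjoint fun x => linkBall e F (g x) (2 ^ (n + 2)) := by
        intro x hx x' hx' hne
        refine Finset.disjoint_left.2 fun u hu hu' => hne ?_
        refine hsep x (hT x hx).1 x' (hT x' hx').1 ?_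
        refine ((((hg x hx).trans (near_of_mem_linkBall h hu)).trans
          ((near_of_mem_linkBall h hu').symm h)).trans ((hg x' hx').symm h)).mono ?_
        rw [pow_add, pow_add]; omega
      have hsub : (T.biUnion fun x => linkBall e F (g x) (2 ^ (n + 2))) ⊆ F :=
        Finset.biUnion_subset.2 fun x hx => linkBall_subset (hgF x hx) _
      have := Finset.card_le_card hsub
      rw [Finset.card_biUnion hdisj] at this
      refine le_trans ?_ this
      rw [← smul_eq_mul]
      refine Finset.card_nsmul_le_sum _ _ _ fun x hx => ?_
      have := le_card_linkBall hF (hgF x hx) (2 ^ (n + 2))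
      omega
    rw [pow_add] at h3 ⊢
    -- At most `2 * T.card ≤ F.card / 2 ^ (n + 1)` neighbours are lost, and `2⁻ⁿ - 2⁻ⁿ⁻¹ = 2⁻ⁿ⁻¹`.
    nlinarith [Nat.mul_le_mul_left (2 ^ n) h2]
  refine ⟨hallOutside_of_linked fun F hF hFD => ?_, hlarge⟩
  rcases lt_or_ge F.card (2 ^ (n + 2)) with hlt | hle
  · exact hsmall F hF hFD hlt
  · have := hlarge F hF hFD hle
    exact Nat.le_of_mul_le_mul_left ((Nat.mul_le_mul_right _ (Nat.le_succ _)).trans this)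
      (by positivity)

end Combinatorics

/-! ### Measurable choices and Borel matchings. -/

section Measurability

variable {V I α : Type*} [MeasurableSpace α] [MeasurableSpace V]

theorem Measurable.eq_of_countablySeparated [MeasurableSpace.CountablySeparated V] {f g : α → V}
    (hf : Measurable f) (hg : Measurable g) : Measurable fun x => f x = g x := by
  obtain ⟨b, hb, hinj⟩ := MeasurableSpace.measurable_injection_nat_bool_of_countablySeparated V
  have h : (fun x => f x = g x) = fun x => ∀ n, b (f x) n = b (g x) n := by
    ext x
    rw [← funext_iff, hinj.eq_iff]
  rw [h]
  refine Measurable.forall fun n => measurableSet_setOfPred.1 (measurableSet_eq_fun ?_ ?_)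
  · exact (measurable_pi_apply n).comp (hb.comp hf)
  · exact (measurable_pi_apply n).comp (hb.comp hg)

theorem measurable_foldr {e : I → V → V} (he : ∀ i, Measurable (e i)) (l : List I) :
    Measurable fun v => l.foldr e v := by
  induction l with
  | nil => exact measurable_id
  | cons i l ih => exact (he i).comp ih

open Classical in
theorem measurable_card_image_filter [MeasurableSpace.CountablySeparated V] {K : Type*}
    {g : K → α → V} {p : K → α → Prop} (hg : ∀ k, Measurable (g k)) (hp : ∀ k, Measurable (p k))
    (J : Finset K) : Measurable fun x => ((J.filter (p · x)).image (g · x)).card := by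
  induction J using Finset.induction_on with
  | empty => simp
  | insert a J _ ih =>
    have hq : Measurable fun x => p a x ∧ ¬ ∃ b : J, p b x ∧ g b x = g a x :=
      (hp a).and (Measurable.exists fun b : J =>
        (hp b.1).and ((hg b.1).eq_of_countablySeparated (hg a))).not
    have h : (fun x => (((insert a J).filter (p · x)).image (g · x)).card) = fun x =>
        ((J.filter (p · x)).image (g · x)).card +
          if p a x ∧ ¬ ∃ b : J, p b x ∧ g b x = g a x then 1 else 0 := by
      ext x
      by_cases hpa : p a x
      · rw [Finset.filter_insert, if_pos hpa, Finset.image_insert, Finset.card_insert_eq_ite]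
        by_cases hm : g a x ∈ (J.filter (p · x)).image (g · x)
        · rw [if_pos hm, if_neg]
          · rfl
          · simp only [Finset.mem_image, Finset.mem_filter] at hm
            obtain ⟨b, ⟨hb, hpb⟩, hbx⟩ := hm
            exact fun h => h.2 ⟨⟨b, hb⟩, hpb, hbx⟩
        · rw [if_neg hm, if_pos]
          refine ⟨hpa, fun ⟨b, hpb, hbx⟩ => hm ?_⟩
          exact Finset.mem_image.2 ⟨b, Finset.mem_filter.2 ⟨b.2, hpb⟩, hbx⟩
      · rw [Finset.filter_insert, if_neg hpa, if_neg fun h => hpa h.1]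
        rfl
    rw [h]
    exact ih.add (Measurable.ite (measurableSet_setOfPred.2 hq) measurable_const measurable_const)

/-- Take the first index that works in an enumeration of `I`; the second disjunct of `q` makes the
search terminate where no index works. -/
theorem exists_measurable_selection [Countable I] {p : I → α → Prop} {g : I → α → V}
    (hp : ∀ i, Measurable (p i)) (hg : ∀ i, Measurable (g i)) {g₀ : α → V} (hg₀ : Measurable g₀) :
    ∃ f : α → V, Measurable f ∧ ∀ x, (∃ i, p i x) → ∃ i, p i x ∧ f x = g i x := by
  classical
  have := Encodable.ofCountable I
  let q : ℕ → α → Prop := fun n x =>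
    (∃ i, Encodable.decode n = some i ∧ p i x) ∨ ∀ i, ¬ p i x
  have hq : ∀ x, ∃ n, q n x := fun x => by
    by_cases h : ∃ i, p i x
    · obtain ⟨i, hi⟩ := h
      exact ⟨Encodable.encode i, Or.inl ⟨i, Encodable.encodek i, hi⟩⟩
    · exact ⟨0, Or.inr (not_exists.1 h)⟩
  let G : ℕ → α → V := fun n => ((Encodable.decode n : Option I).map g).getD g₀
  have hG : ∀ n, Measurable (G n) := fun n => by
    cases h : (Encodable.decode n : Option I) with
    | none => simpa [G, h] using hg₀
    | some i => simpa [G, h] using hg i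
  refine ⟨fun x => G (Nat.find (hq x)) x, Measurable.find hG (fun n => measurableSet_setOfPred.2 ?_) hq,
    fun x hx => ?_⟩
  · exact (Measurable.exists fun i => measurable_const.and (hp i)).or
      (Measurable.forall fun i => (hp i).not)
  · rcases Nat.find_spec (hq x) with ⟨i, hi, hpi⟩ | h
    · exact ⟨i, hpi, by simp [G, hi]⟩
    · exact absurd hx (not_exists.2 h)

/-- A measurable matching, given as an involution that fixes exactly the unmatched vertices. -/
structure IsPartialMatching (e : I → V → V) (m : V → V) : Prop where
  measurable : Measurable m
  invol : ∀ v, m (m v) = v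
  edge : ∀ v, m v = v ∨ ∃ i, e i v = m v

variable [Fintype I] {e : I → V → V} {c : V → Bool}

-- By `hallOutside_union_pair_iff` the condition ranges over the countably many finite sets of
-- words, and each instance compares two measurable cardinalities.
open Classical in
theorem measurable_hallOutside_union_pair [MeasurableSpace.CountablySeparated V]
    (h : IsBipartiteFamily e c) (he : ∀ i, Measurable (e i)) {D : Set V} (hDm : MeasurableSet D)
    (hD : HallOutside e D) (i : I) :
    Measurable fun x => HallOutside e (D ∪ {x, e i x}) := by
  simp only [hallOutside_union_pair_iff h hD]
  have hw := measurable_foldr he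
  have hmem : ∀ g : V → V, Measurable g → Measurable fun x => g x ∉ D ∪ {x, e i x} := by
    intro g hg
    simp only [Set.mem_union, Set.mem_insert_iff, Set.mem_singleton_iff]
    exact (((measurableSet_setOfPred.1 hDm).comp hg).or
      ((hg.eq_of_countablySeparated measurable_id).or (hg.eq_of_countablySeparated (he i)))).not
  refine Measurable.forall fun J => Measurable.imp ?_ ?_
  · exact Measurable.forall fun l => measurable_const.imp (hmem _ (hw l))
  · have h1 := measurable_card_image_filter (p := fun _ _ => True) hw
      (fun _ => measurable_const) J
    have h2 := measurable_card_image_filter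
      (g := fun (q : List I × I) x => e q.2 (q.1.foldr e x))
      (p := fun q x => e q.2 (q.1.foldr e x) ∉ D ∪ {x, e i x})
      (fun q => (he q.2).comp (hw q.1)) (fun q => hmem _ ((he q.2).comp (hw q.1)))
      (J ×ˢ Finset.univ)
    have h3 : ∀ x, outNbhd e (D ∪ {x, e i x}) (J.image fun l => l.foldr e x) =
        ((J ×ˢ Finset.univ).filter fun q : List I × I =>
          e q.2 (q.1.foldr e x) ∉ D ∪ {x, e i x}).image fun q => e q.2 (q.1.foldr e x) := by
      intro x
      ext y
      simp only [mem_outNbhd, Finset.mem_image, Finset.mem_filter, Finset.mem_product,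
        Finset.mem_univ, and_true, Prod.exists]
      constructor
      · rintro ⟨⟨v, ⟨l, hl, rfl⟩, j, rfl⟩, hy⟩
        exact ⟨l, j, ⟨hl, hy⟩, rfl⟩
      · rintro ⟨l, j, ⟨hl, hy⟩, rfl⟩
        exact ⟨⟨_, ⟨l, hl, rfl⟩, j, rfl⟩, hy⟩
    simp only [h3]
    simp only [Finset.filter_true] at h1
    exact measurableSet_setOfPred.1 (measurableSet_le h1 (by convert h2))

/-- The edges of `exists_edge` are chosen measurably at the unmatched points of `A`. Separation
makes them pairwise disjoint, so they can be added to `m` together. -/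
theorem IsPartialMatching.exists_extension [MeasurableSpace.CountablySeparated V]
    (h : IsBipartiteFamily e c) (he : ∀ i, Measurable (e i)) {m : V → V}
    (hm : IsPartialMatching e m) {n : ℕ} (hH : HallOutside e {v | m v ≠ v})
    (hE : ExpandsOutside e n {v | m v ≠ v}) {A : Set V} (hA : MeasurableSet A)
    (hsep : ∀ x ∈ A, ∀ y ∈ A, Near e (2 ^ (n + 5)) x y → x = y) :
    ∃ m' : V → V, IsPartialMatching e m' ∧ HallOutside e {v | m' v ≠ v} ∧
      ExpandsOutside e (n + 1) {v | m' v ≠ v} ∧ (∀ v, m v ≠ v → m' v = m v) ∧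
      ∀ v ∈ A, m' v ≠ v := by
  set D := {v | m v ≠ v} with hD
  have hDm : MeasurableSet D :=
    measurableSet_setOfPred.2 (hm.measurable.eq_of_countablySeparated measurable_id).not
  have hne : ∀ i v, e i v ≠ v := fun i v hv => by
    have := h.side i v
    rw [hv] at this
    cases c v <;> simp at this
  obtain ⟨s, hsm, hs⟩ := exists_measurable_selection
    (p := fun i x => e i x ∉ D ∧ HallOutside e (D ∪ {x, e i x})) (g := e) (g₀ := id)
    (fun i => ((measurableSet_setOfPred.1 hDm).comp (he i)).not.and
      (measurable_hallOutside_union_pair h he hDm hH i)) he measurable_id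
  have hs' : ∀ x, x ∉ D → ∃ i, s x = e i x ∧ s x ∉ D ∧ HallOutside e (D ∪ {x, s x}) := by
    intro x hx
    obtain ⟨i, ⟨h1, h2⟩, h3⟩ := hs x (hH.exists_edge h hx)
    exact ⟨i, h3, h3 ▸ h1, h3 ▸ h2⟩
  set U := A \ D with hU
  have hUm : MeasurableSet U := hA.diff hDm
  have hUp : Measurable fun v => v ∈ U := measurableSet_setOfPred.1 hUm
  have hnear : ∀ x ∈ U, Near e 1 x (s x) := fun x hx => by
    obtain ⟨i, hi, -⟩ := hs' x hx.2
    rw [hi]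
    exact Near.single i x
  have hpow : 2 ≤ 2 ^ (n + 5) := by
    rw [pow_add]
    have : 1 ≤ 2 ^ n := Nat.one_le_two_pow
    omega
  have hsne : ∀ x ∈ U, s x ≠ x := fun x hx => by
    obtain ⟨i, hi, -⟩ := hs' x hx.2
    rw [hi]
    exact hne i x
  have hsU : ∀ x ∈ U, s x ∉ U := fun x hx hsx =>
    hsne x hx (hsep x hx.1 _ hsx.1 ((hnear x hx).mono (by omega))).symm
  have hinj : ∀ x ∈ U, ∀ y ∈ U, s x = s y → x = y := fun x hx y hy hxy =>
    hsep x hx.1 y hy.1 (((hnear x hx).trans (hxy ▸ (hnear y hy).symm h)).mono hpow)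
  -- The cases are: a point of `U`, a point left to `m`, and a point of `s '' U` whose preimage is
  -- its `j`-th neighbour. Naming the preimage by an edge keeps the inverse of `s` measurable.
  let p : Option (Option I) → V → Prop
    | none => fun v => v ∈ U
    | some none => fun v => v ∉ U ∧ ∀ j, ¬ (e j v ∈ U ∧ s (e j v) = v)
    | some (some j) => fun v => v ∉ U ∧ e j v ∈ U ∧ s (e j v) = v
  let g : Option (Option I) → V → V
    | none => s
    | some none => m
    | some (some j) => e j
  have hq : ∀ j, Measurable fun v => e j v ∈ U ∧ s (e j v) = v := fun j =>
    (hUp.comp (he j)).and ((hsm.comp (he j)).eq_of_countablySeparated measurable_id)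
  obtain ⟨m', hm'm, hm'⟩ := exists_measurable_selection (p := p) (g := g) (g₀ := id)
    (by
      rintro (_ | _ | j)
      · exact hUp
      · exact hUp.not.and (Measurable.forall fun j => (hq j).not)
      · exact hUp.not.and (hq j))
    (by
      rintro (_ | _ | j)
      · exact hsm
      · exact hm.measurable
      · exact he j) measurable_id
  have hcases : ∀ v, (v ∈ U ∧ m' v = s v) ∨ (v ∉ U ∧ m' v ∈ U ∧ s (m' v) = v ∧ ∃ j, e j v = m' v) ∨
      (v ∉ U ∧ v ∉ s '' U ∧ m' v = m v) := by
    intro v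
    have hex : ∃ k, p k v := by
      by_cases hvU : v ∈ U
      · exact ⟨none, hvU⟩
      by_cases hj : ∃ j, e j v ∈ U ∧ s (e j v) = v
      · obtain ⟨j, hj⟩ := hj
        exact ⟨some (some j), hvU, hj⟩
      · exact ⟨some none, hvU, not_exists.1 hj⟩
    obtain ⟨k, hk, hmk⟩ := hm' v hex
    rcases k with _ | _ | j
    · exact Or.inl ⟨hk, hmk⟩
    · refine Or.inr (Or.inr ⟨hk.1, ?_, hmk⟩)
      rintro ⟨x, hx, rfl⟩
      obtain ⟨i, hi, -⟩ := hs' x hx.2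
      obtain ⟨j, hj⟩ := h.symm i x
      rw [← hi] at hj
      exact hk.2 j ⟨hj.symm ▸ hx, by rw [hj]⟩
    · have hmk' : m' v = e j v := hmk
      exact Or.inr (Or.inl ⟨hk.1, hmk' ▸ hk.2.1, hmk' ▸ hk.2.2, j, hmk'.symm⟩)
  have hmU : ∀ v ∈ U, m' v = s v := fun v hv => by
    rcases hcases v with h1 | h1 | h1
    · exact h1.2
    · exact absurd hv h1.1
    · exact absurd hv h1.1
  have hms : ∀ v ∈ U, m' (s v) = v := fun v hv => by
    rcases hcases (s v) with h1 | h1 | h1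
    · exact absurd h1.1 (hsU v hv)
    · exact hinj _ h1.2.1 _ hv h1.2.2.1
    · exact absurd ⟨v, hv, rfl⟩ h1.2.1
  have hD' : {v | m' v ≠ v} = D ∪ U ∪ s '' U := by
    ext v
    simp only [Set.mem_ofPred_eq, Set.mem_union]
    rcases hcases v with ⟨hv, h1⟩ | ⟨hv, h1, h2, -⟩ | ⟨hv, h1, h2⟩
    · rw [h1]
      exact ⟨fun _ => Or.inl (Or.inr hv), fun _ => hsne v hv⟩
    · exact ⟨fun _ => Or.inr ⟨_, h1, h2⟩, fun _ h3 => hv (h3 ▸ h1)⟩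
    · rw [h2]
      exact ⟨fun h3 => Or.inl (Or.inl h3), fun h3 => h3.elim
        (fun h3 => h3.elim id fun h3 => absurd h3 hv) fun h3 => absurd h3 h1⟩
  obtain ⟨hH', hE'⟩ := hall_and_expands_of_separated (U := U) (s := s) h hH hE
    (fun x hx => let ⟨i, hi, _⟩ := hs' x hx.2; ⟨i, hi.symm⟩)
    (fun x hx => let ⟨_, _, _, hi⟩ := hs' x hx.2; hi)
    fun x hx y hy => hsep x hx.1 y hy.1
  refine ⟨m', ⟨hm'm, fun v => ?_, fun v => ?_⟩, hD' ▸ hH', hD' ▸ hE', fun v hv => ?_, fun v hv => ?_⟩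
  · rcases hcases v with ⟨hv, h1⟩ | ⟨hv, h1, h2, -⟩ | ⟨hv, h1, h2⟩
    · rw [h1, hms v hv]
    · rw [hmU _ h1, h2]
    · rw [h2]
      rcases hcases (m v) with ⟨hv', h3⟩ | ⟨hv', h3, h4, -⟩ | ⟨hv', h3, h4⟩
      · have h5 : m (m v) = m v := not_not.1 hv'.2
        rw [hm.invol] at h5
        exact absurd (h5 ▸ hv') hv
      · obtain ⟨i, -, h5, -⟩ := hs' _ h3.2
        have h6 : m (m v) = m v := by rw [h4] at h5; exact not_not.1 h5
        rw [hm.invol] at h6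
        exact absurd ⟨_, h3, h4.trans h6.symm⟩ h1
      · rw [h4, hm.invol]
  · rcases hcases v with ⟨hv, h1⟩ | ⟨hv, h1, h2, h3⟩ | ⟨hv, h1, h2⟩
    · obtain ⟨i, hi, -⟩ := hs' v hv.2
      exact Or.inr ⟨i, by rw [h1, hi]⟩
    · exact Or.inr h3
    · rw [h2]
      exact hm.edge v
  · rcases hcases v with ⟨hv', h1⟩ | ⟨hv', h1, h2, -⟩ | ⟨hv', h1, h2⟩
    · exact absurd hv hv'.2
    · obtain ⟨i, -, h5, -⟩ := hs' _ h1.2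
      rw [h2] at h5
      exact absurd hv h5
    · exact h2
  · change v ∈ {v | m' v ≠ v}
    rw [hD']
    by_cases hvD : v ∈ D
    · exact Or.inl (Or.inl hvD)
    · exact Or.inl (Or.inr ⟨hv, hvD⟩)

/-- A bipartite graph generated by finitely many measurable maps, in which the neighbourhood of
every finite set is twice as large, has a measurable matching that covers any given sequence of
sufficiently sparse measurable sets. -/
theorem exists_isPartialMatching [MeasurableSpace.CountablySeparated V]
    (h : IsBipartiteFamily e c) (he : ∀ i, Measurable (e i))
    (hexp : ∀ F : Finset V, 2 * F.card ≤ (outNbhd e ∅ F).card) {A : ℕ → Set V}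
    (hA : ∀ n, MeasurableSet (A n))
    (hsep : ∀ n, ∀ x ∈ A n, ∀ y ∈ A n, Near e (2 ^ (n + 5)) x y → x = y) :
    ∃ m : V → V, IsPartialMatching e m ∧ ∀ n, ∀ v ∈ A n, m v ≠ v := by
  let S : ℕ → Type _ := fun n => {m : V → V // IsPartialMatching e m ∧
    HallOutside e {v | m v ≠ v} ∧ ExpandsOutside e n {v | m v ≠ v}}
  have hstep : ∀ n (m : S n), ∃ m' : S (n + 1), (∀ v, m.1 v ≠ v → m'.1 v = m.1 v) ∧
      ∀ v ∈ A n, m'.1 v ≠ v := fun n ⟨m, h1, h2, h3⟩ => by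
    obtain ⟨m', h4, h5, h6, h7⟩ := h1.exists_extension h he h2 h3 (hA n) (hsep n)
    exact ⟨⟨m', h4, h5, h6⟩, h7⟩
  choose next hnext hcov using hstep
  have hid : {v : V | id v ≠ v} = ∅ := by ext; simp
  -- For the empty matching, expansion at level 0 is exactly the factor 2 of `hexp`.
  let m₀ : S 0 := ⟨id, ⟨measurable_id, fun _ => rfl, fun _ => Or.inl rfl⟩,
    fun F _ => by rw [hid]; have := hexp F; omega,
    fun F _ _ _ => by rw [hid]; simpa using hexp F⟩
  let M : ∀ n, S n := fun n => Nat.rec m₀ next n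
  let f : ℕ → V → V := fun n => (M n).1
  have hf : ∀ n, IsPartialMatching e (f n) := fun n => (M n).2.1
  have hext : ∀ n k v, f n v ≠ v → f (n + k) v = f n v := by
    intro n k v hv
    induction k with
    | zero => rfl
    | succ k ih =>
      rw [← ih] at hv ⊢
      exact hnext (n + k) (M (n + k)) v hv
  have hfcov : ∀ n, ∀ v ∈ A n, f (n + 1) v ≠ v := fun n => hcov n (M n)
  -- Once matched, a vertex keeps its partner, so the stages converge pointwise by being eventually
  -- constant.
  have hlim : ∀ v, ∃ w, ∃ N, ∀ n, f (N + n) v = w := by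
    intro v
    by_cases hv : ∃ n, f n v ≠ v
    · obtain ⟨n, hn⟩ := hv
      exact ⟨_, n, fun k => hext n k v hn⟩
    · push Not at hv
      exact ⟨v, 0, fun n => hv _⟩
  choose m N hm using hlim
  have hmeq : ∀ v n, N v ≤ n → f n v = m v := fun v n hn => by
    obtain ⟨k, rfl⟩ := Nat.exists_eq_add_of_le hn
    exact hm v k
  refine ⟨m, ⟨fun B hB => ?_, fun v => ?_, fun v => ?_⟩, fun n v hv => ?_⟩
  · have : m ⁻¹' B = ⋃ K : ℕ, ⋂ k : ℕ, f (K + k) ⁻¹' B := by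
      ext v
      simp only [Set.mem_preimage, Set.mem_iUnion, Set.mem_iInter]
      constructor
      · exact fun hv => ⟨N v, fun k => by rwa [hm v k]⟩
      · rintro ⟨K, hK⟩
        rw [← hmeq v (K + N v) (by omega)]
        exact hK _
    rw [this]
    exact MeasurableSet.iUnion fun K => MeasurableSet.iInter fun k => (hf _).measurable hB
  · obtain ⟨K, h1, h2⟩ : ∃ K, N v ≤ K ∧ N (m v) ≤ K := ⟨_, le_max_left _ _, le_max_right _ _⟩
    rw [← hmeq (m v) K h2, ← hmeq v K h1, (hf K).invol]
  · rw [← hmeq v _ le_rfl]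
    exact (hf _).edge v
  · have h1 := hfcov n v hv
    rw [← hmeq v (n + 1 + N v) (by omega), hext (n + 1) (N v) v h1]
    exact h1

end Measurability

/-! ### Sparse Borel covers and Baire category. -/

section SparseCover

/-- Code points by binary sequences. For each of the finitely many short words, record either that
it fixes the point or a coordinate and bit at which it changes the code. There are countably many
such records, and two points with the same record cannot be joined by a short nontrivial walk. -/
theorem exists_countable_sparse_cover {V I : Type*} [MeasurableSpace V]
    [MeasurableSpace.CountablySeparated V] [Finite I] {e : I → V → V}
    (he : ∀ i, Measurable (e i)) (k : ℕ) :
    ∃ C : ℕ → Set V, (∀ n, MeasurableSet (C n)) ∧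
      (∀ n, ∀ v ∈ C n, ∀ w ∈ C n, Near e k v w → v = w) ∧ ∀ v, ∃ n, v ∈ C n := by
  classical
  obtain ⟨b, hb, hinj⟩ := MeasurableSpace.measurable_injection_nat_bool_of_countablySeparated V
  let K := {l : List I // l.length ≤ k}
  have hK : Finite K := (List.finite_length_le I k).to_subtype
  let p : Option (ℕ × Bool) → List I → V → Prop
    | none, l, v => l.foldr e v = v
    | some (n, t), l, v => b v n = t ∧ b (l.foldr e v) n = !t
  let C : (K → Option (ℕ × Bool)) → Set V := fun q => {v | ∀ l : K, p (q l) l v}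
  obtain ⟨s, hs⟩ := exists_surjective_nat (K → Option (ℕ × Bool))
  refine ⟨fun n => C (s n), fun n => ?_, fun n v hv w hw hvw => ?_, fun v => ?_⟩
  · refine measurableSet_setOfPred.2 (Measurable.forall fun l => ?_)
    have hw := measurable_foldr he l.1
    rcases h : s n l with _ | ⟨i, t⟩
    · exact hw.eq_of_countablySeparated measurable_id
    · have hbi : Measurable fun v => b v i := (measurable_pi_apply i).comp hb
      exact (measurableSet_setOfPred.1 (measurableSet_eq_fun hbi measurable_const)).and
        (measurableSet_setOfPred.1 (measurableSet_eq_fun (hbi.comp hw) measurable_const))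
  · obtain ⟨l, hl, rfl⟩ := hvw
    have h1 := hv ⟨l, hl⟩
    have h2 := hw ⟨l, hl⟩
    rcases h : s n ⟨l, hl⟩ with _ | ⟨i, t⟩
    · rw [h] at h1
      exact Eq.symm h1
    · rw [h] at h1 h2
      have h3 := h1.2.symm.trans h2.1
      cases t <;> simp at h3
  · have hsep : ∀ w, w ≠ v → ∃ n, b w n = !b v n := fun w hw => by
      by_contra hno
      push Not at hno
      exact hw (hinj (funext fun n => by simpa using hno n))
    choose! d hd using hsep
    obtain ⟨n, hn⟩ := hs fun l =>
      if l.1.foldr e v = v then none else some (d (l.1.foldr e v), b v (d (l.1.foldr e v)))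
    refine ⟨n, fun l => ?_⟩
    rw [hn]
    by_cases hl : l.1.foldr e v = v
    · simp only [if_pos hl]
      exact hl
    · simp only [if_neg hl]
      exact ⟨rfl, hd _ hl⟩

/-- A nonmeagre set with the Baire property is comeagre in some nonempty basic open set. -/
theorem BaireMeasurableSet.isMeagre_of_forall_inter {X : Type*} [TopologicalSpace X]
    {s : Set X} (hs : BaireMeasurableSet s) {B : Set (Set X)}
    (hB : TopologicalSpace.IsTopologicalBasis B)
    (h : ∀ U ∈ B, U.Nonempty → ¬ IsMeagre (U \ s)) : IsMeagre s := by
  obtain ⟨u, hu, hsu⟩ := hs.residualEq_isOpen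
  rcases u.eq_empty_or_nonempty with rfl | ⟨x, hx⟩
  · filter_upwards [hsu] with y hy
    have : (y ∈ s) = (y ∈ (∅ : Set X)) := hy
    simp [this]
  · obtain ⟨U, hU, hxU, hUu⟩ := hB.exists_subset_of_mem_open hx hu
    refine absurd ?_ (h U hU ⟨x, hxU⟩)
    filter_upwards [hsu] with y hy
    have hy' : (y ∈ s) = (y ∈ u) := hy
    exact fun hyU => hyU.2 (hy'.symm ▸ hUu hyU.1)

/-- Diagonalise over pairs of a label `l` and a basic open `U`: the `n`-th choice catches `f l x`
for nonmeagrely many `x` in `U`. The points missed for a fixed `l` then form a Borel set whose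
complement is nonmeagre in every `U`. -/
theorem exists_choice_isMeagre {X V L : Type*} [TopologicalSpace X] [BaireSpace X]
    [SecondCountableTopology X] [MeasurableSpace X] [BorelSpace X] [MeasurableSpace V]
    [Countable L] {f : L → X → V} (hf : ∀ l, Measurable (f l)) {C : ℕ → ℕ → Set V}
    (hC : ∀ n j, MeasurableSet (C n j)) (hcov : ∀ n v, ∃ j, v ∈ C n j) :
    ∃ q : ℕ → ℕ, IsMeagre {x | ∃ l, ∀ n, f l x ∉ C n (q n)} := by
  have hcount : (TopologicalSpace.countableBasis X).Countable :=
    TopologicalSpace.countable_countableBasis X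
  have : Countable (TopologicalSpace.countableBasis X) := hcount
  have := Encodable.ofCountable (L × TopologicalSpace.countableBasis X)
  have hex : ∀ n, ∃ j, ∀ z : L × TopologicalSpace.countableBasis X, Encodable.decode n = some z →
      ¬ IsMeagre (z.2.1 ∩ f z.1 ⁻¹' C n j) := by
    intro n
    rcases h : (Encodable.decode n : Option (L × TopologicalSpace.countableBasis X)) with _ | ⟨l, U, hU⟩
    · exact ⟨0, fun z hz => by simp at hz⟩
    · have hUm : ¬ IsMeagre U := not_isMeagre_of_isOpen
        (TopologicalSpace.isOpen_of_mem_countableBasis hU)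
        (TopologicalSpace.nonempty_of_mem_countableBasis hU)
      by_contra hno
      push Not at hno
      refine hUm ((isMeagre_iUnion fun j => ?_).mono
        (show U ⊆ ⋃ j, U ∩ f l ⁻¹' C n j from fun x hx => ?_))
      · obtain ⟨z, hz, hm⟩ := hno j
        obtain rfl := Option.some.inj hz
        exact hm
      · obtain ⟨j, hj⟩ := hcov n (f l x)
        exact Set.mem_iUnion.2 ⟨j, hx, hj⟩
  choose q hq using hex
  refine ⟨q, ?_⟩
  have hunion : {x | ∃ l, ∀ n, f l x ∉ C n (q n)} = ⋃ l, {x | ∀ n, f l x ∉ C n (q n)} := by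
    ext x
    simp
  rw [hunion]
  refine isMeagre_iUnion fun l => ?_
  have hm : MeasurableSet {x | ∀ n, f l x ∉ C n (q n)} :=
    measurableSet_setOfPred.2 (Measurable.forall fun n =>
      ((measurableSet_setOfPred.1 (hC n (q n))).comp (hf l)).not)
  refine hm.baireMeasurableSet.isMeagre_of_forall_inter
    (TopologicalSpace.isBasis_countableBasis X) fun U hU _ hmeagre => ?_
  refine hq _ (l, ⟨U, hU⟩) (Encodable.encodek _) (hmeagre.mono ?_)
  exact fun x hx => ⟨hx.1, fun hx' => hx' _ hx.2⟩

end SparseCover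

/-! ### From decompositions to matchings and back. -/

section Paradox

variable {Γ X : Type*} [Group Γ] [MulAction Γ X]

theorem IsParadoxicalDecomposition.exists_bijective {n m : ℕ} {A : Fin n → Set X}
    {B : Fin m → Set X} (h : IsParadoxicalDecomposition Γ A B) :
    ∃ (S : Finset Γ) (f : X → X × Bool), f.Bijective ∧ ∀ x, ∃ γ ∈ S, (f x).1 = γ • x := by
  classical
  obtain ⟨α, hα, hα'⟩ := h.exists_left
  obtain ⟨β, hβ, hβ'⟩ := h.exists_right
  let R : X → X × Bool → Prop := fun x p =>
    (p.2 = true ∧ ∃ i, x ∈ A i ∧ p.1 = α i • x) ∨ (p.2 = false ∧ ∃ j, x ∈ B j ∧ p.1 = β j • x)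
  have hex : ∀ x, ∃ p, R x p := by
    intro x
    have hx : x ∈ (⋃ i, A i) ∪ ⋃ j, B j := h.cover ▸ Set.mem_univ x
    rcases hx with hx | hx
    · obtain ⟨i, hi⟩ := Set.mem_iUnion.1 hx
      exact ⟨(α i • x, true), Or.inl ⟨rfl, i, hi, rfl⟩⟩
    · obtain ⟨j, hj⟩ := Set.mem_iUnion.1 hx
      exact ⟨(β j • x, false), Or.inr ⟨rfl, j, hj, rfl⟩⟩
  have hA : ∀ x i i', x ∈ A i → x ∈ A i' → i = i' := fun x i i' hi hi' => by
    by_contra hne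
    exact Set.disjoint_left.1 (h.disjoint_left i i' hne) hi hi'
  have hB : ∀ x i i', x ∈ B i → x ∈ B i' → i = i' := fun x i i' hi hi' => by
    by_contra hne
    exact Set.disjoint_left.1 (h.disjoint_right i i' hne) hi hi'
  have hfun : ∀ x p p', R x p → R x p' → p = p' := by
    rintro x ⟨y, k⟩ ⟨y', k'⟩ (⟨hk, i, hi, hy⟩ | ⟨hk, i, hi, hy⟩)
      (⟨hk', i', hi', hy'⟩ | ⟨hk', i', hi', hy'⟩)
    · obtain rfl := hA x i i' hi hi'
      exact Prod.ext (hy.trans hy'.symm) (hk.trans hk'.symm)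
    · exact absurd hi' (Set.disjoint_left.1 (h.disjoint_left_right i i') hi)
    · exact absurd hi (Set.disjoint_left.1 (h.disjoint_left_right i' i) hi')
    · obtain rfl := hB x i i' hi hi'
      exact Prod.ext (hy.trans hy'.symm) (hk.trans hk'.symm)
  choose f hf using hex
  refine ⟨Finset.univ.image α ∪ Finset.univ.image β, f, ⟨fun x x' hxx' => ?_, fun p => ?_⟩,
    fun x => ?_⟩
  · have h1 := hf x
    have h2 := hf x'
    rw [← hxx'] at h2
    rcases h1 with ⟨hk, i, hi, hy⟩ | ⟨hk, i, hi, hy⟩ <;>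
      rcases h2 with ⟨hk', i', hi', hy'⟩ | ⟨hk', i', hi', hy'⟩
    · have hii' : i = i' := by
        by_contra hne
        exact Set.disjoint_left.1 (hα i i' hne) ⟨x, hi, hy.symm⟩ ⟨x', hi', hy'.symm⟩
      subst hii'
      exact MulAction.injective (α i) (hy.symm.trans hy')
    · simp [hk] at hk'
    · simp [hk] at hk'
    · have hii' : i = i' := by
        by_contra hne
        exact Set.disjoint_left.1 (hβ i i' hne) ⟨x, hi, hy.symm⟩ ⟨x', hi', hy'.symm⟩
      subst hii'
      exact MulAction.injective (β i) (hy.symm.trans hy')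
  · obtain ⟨y, _ | _⟩ := p
    · have hy : y ∈ ⋃ j, β j • B j := hβ' ▸ Set.mem_univ y
      obtain ⟨j, x, hx, rfl⟩ := Set.mem_iUnion.1 hy
      exact ⟨x, hfun x _ _ (hf x) (Or.inr ⟨rfl, j, hx, rfl⟩)⟩
    · have hy : y ∈ ⋃ j, α j • A j := hα' ▸ Set.mem_univ y
      obtain ⟨j, x, hx, rfl⟩ := Set.mem_iUnion.1 hy
      exact ⟨x, hfun x _ _ (hf x) (Or.inl ⟨rfl, j, hx, rfl⟩)⟩
  · rcases hf x with ⟨-, i, -, hy⟩ | ⟨-, i, -, hy⟩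
    · exact ⟨α i, by simp, hy⟩
    · exact ⟨β i, by simp, hy⟩

theorem exists_isParadoxicalDecomposition_of_bijective [TopologicalSpace X] {T : Finset Γ}
    {f : X → X × Bool} (hf : f.Bijective) (hT : ∀ x, ∃ γ ∈ T, (f x).1 = γ • x)
    (hm : ∀ γ ∈ T, ∀ k, BaireMeasurableSet {x | f x = (γ • x, k)}) :
    ∃ (n m : ℕ) (A : Fin n → Set X) (B : Fin m → Set X), IsParadoxicalDecomposition Γ A B ∧
      (∀ i, BaireMeasurableSet (A i)) ∧ ∀ j, BaireMeasurableSet (B j) := by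
  classical
  let t : Fin T.card → Γ := fun i => (T.equivFin.symm i).1
  -- Several elements of `T` may move `x` to the same point, so the least index is used to make the
  -- pieces disjoint.
  let P : Bool → Fin T.card → Set X := fun k i =>
    {x | f x = (t i • x, k)} \ ⋃ i' : {i' // i' < i}, {x | f x = (t i' • x, k)}
  have hPm : ∀ k i, BaireMeasurableSet (P k i) := fun k i =>
    (hm _ (T.equivFin.symm i).2 k).diff
      (BaireMeasurableSet.iUnion fun i' => hm _ (T.equivFin.symm i'.1).2 k)
  have hPf : ∀ {k i x}, x ∈ P k i → f x = (t i • x, k) := fun hx => hx.1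
  have hlt : ∀ {k i i' x}, x ∈ P k i → x ∈ P k i' → ¬ i < i' := fun hx hx' hlt =>
    hx'.2 (Set.mem_iUnion.2 ⟨⟨_, hlt⟩, hPf hx⟩)
  have huniq : ∀ {k i i' x}, x ∈ P k i → x ∈ P k i' → i = i' := fun hx hx' =>
    le_antisymm (not_lt.1 (hlt hx' hx)) (not_lt.1 (hlt hx hx'))
  have hcov : ∀ x, ∃ i, x ∈ P (f x).2 i := by
    intro x
    obtain ⟨γ, hγ, hx⟩ := hT x
    have hex : ∃ i, f x = (t i • x, (f x).2) :=
      ⟨T.equivFin ⟨γ, hγ⟩, Prod.ext (by simpa [t] using hx) rfl⟩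
    obtain ⟨i, hi, hmin⟩ := WellFounded.has_min wellFounded_lt
      {i | f x = (t i • x, (f x).2)} hex
    refine ⟨i, hi, fun hx' => ?_⟩
    obtain ⟨⟨i', hi'⟩, hx'⟩ := Set.mem_iUnion.1 hx'
    exact hmin i' hx' hi'
  have htrans : ∀ k, ∃ α : Fin T.card → Γ,
      (∀ i i', i ≠ i' → Disjoint (α i • P k i) (α i' • P k i')) ∧
      (⋃ i, α i • P k i) = Set.univ := by
    refine fun k => ⟨t, fun i i' hne => Set.disjoint_left.2 ?_, Set.eq_univ_of_forall fun y => ?_⟩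
    · rintro _ ⟨x, hx, rfl⟩ ⟨x', hx', hxx'⟩
      have hfx : f x' = f x := by rw [hPf hx, hPf hx']; exact Prod.ext hxx' rfl
      obtain rfl := hf.1 hfx
      exact hne (huniq hx hx')
    · obtain ⟨x, hx⟩ := hf.2 (y, k)
      obtain ⟨i, hi⟩ := hcov x
      rw [hx] at hi
      refine Set.mem_iUnion.2 ⟨i, x, hi, ?_⟩
      have := hPf hi
      rw [hx] at this
      exact (congrArg Prod.fst this).symm
  refine ⟨T.card, T.card, P true, P false, ⟨?_, ?_, ?_, ?_, htrans true, htrans false⟩,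
    hPm true, hPm false⟩
  · exact fun i i' hne => Set.disjoint_left.2 fun x hx hx' => hne (huniq hx hx')
  · exact fun i i' hne => Set.disjoint_left.2 fun x hx hx' => hne (huniq hx hx')
  · refine fun i j => Set.disjoint_left.2 fun x hx hx' => ?_
    have := (hPf hx).symm.trans (hPf hx')
    simp at this
  · refine Set.eq_univ_of_forall fun x => ?_
    obtain ⟨i, hi⟩ := hcov x
    cases hk : (f x).2
    · exact Or.inr (Set.mem_iUnion.2 ⟨i, hk ▸ hi⟩)
    · exact Or.inl (Set.mem_iUnion.2 ⟨i, hk ▸ hi⟩)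

/-- The generators of the graph on three copies of `X` in which `(x, 0)` is joined to `(γ • x, 1)`
and `(γ • x, 2)` for `γ ∈ T`. -/
def doublingMap (T : Finset Γ) (i : T × Bool) (v : X × Fin 3) : X × Fin 3 :=
  (i.1.1 • v.1, if v.2 = 0 then (if i.2 then 1 else 2) else 0)

theorem isBipartiteFamily_doublingMap {T : Finset Γ} (hT : ∀ γ ∈ T, γ⁻¹ ∈ T) :
    IsBipartiteFamily (doublingMap (X := X) T) fun v => decide (v.2 = 0) where
  symm := by
    rintro ⟨γ, b⟩ ⟨x, j⟩
    refine ⟨(⟨γ⁻¹, hT γ γ.2⟩, decide (j = 1)), ?_⟩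
    fin_cases j <;> cases b <;> simp [doublingMap]
  side := by
    rintro ⟨γ, b⟩ ⟨x, j⟩
    fin_cases j <;> cases b <;> simp [doublingMap]

theorem measurable_doublingMap [MeasurableSpace X] {T : Finset Γ}
    (h : ∀ γ : Γ, Measurable fun x : X => γ • x) (i : T × Bool) :
    Measurable (doublingMap (X := X) T i) :=
  ((h _).comp measurable_fst).prodMk
    ((measurable_of_finite fun j : Fin 3 => if j = 0 then (if i.2 then 1 else 2) else 0).comp
      measurable_snd)

/-- The injection `g` embeds copy 0, doubled, into copies 1 and 2. Applied twice, it embeds copies 1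
and 2, doubled, into copy 0; hence the hypothesis on `g ∘ g`. -/
theorem two_mul_card_le_card_outNbhd_doublingMap {T : Finset Γ} {g : X × Bool → X}
    (hg : g.Injective) (h1 : ∀ p, ∃ γ ∈ T, g p = γ • p.1)
    (h2 : ∀ x k k', ∃ γ ∈ T, g (g (x, k), k') = γ • x) (F : Finset (X × Fin 3)) :
    2 * F.card ≤ (outNbhd (doublingMap T) ∅ F).card := by
  classical
  let G : (X × Fin 3) × Bool → X × Fin 3 := fun p =>
    if p.1.2 = 0 then (g (p.1.1, true), if p.2 then 1 else 2)
    else (g (g (p.1.1, decide (p.1.2 = 1)), p.2), 0)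
  have hG : G.Injective := by
    rintro ⟨⟨x, j⟩, b⟩ ⟨⟨x', j'⟩, b'⟩ h
    fin_cases j <;> fin_cases j' <;> cases b <;> cases b' <;>
      simp [G, hg.eq_iff] at h <;> simp [h]
  have hcard : (F ×ˢ (Finset.univ : Finset Bool)).card = 2 * F.card := by
    simp [Finset.card_product, mul_comm]
  rw [← hcard, ← Finset.card_image_of_injective _ hG]
  refine Finset.card_le_card fun w hw => ?_
  obtain ⟨⟨⟨x, j⟩, b⟩, hp, rfl⟩ := Finset.mem_image.1 hw
  refine mem_outNbhd.2 ⟨⟨(x, j), (Finset.mem_product.1 hp).1, ?_⟩, id⟩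
  by_cases hj : j = 0
  · obtain ⟨γ, hγ, h⟩ := h1 (x, true)
    exact ⟨(⟨γ, hγ⟩, b), by simp [doublingMap, G, hj, h]⟩
  · obtain ⟨γ, hγ, h⟩ := h2 x (decide (j = 1)) b
    exact ⟨(⟨γ, hγ⟩, b), by simp [doublingMap, G, hj, h]⟩

theorem exists_bijective_baireMeasurableSet [TopologicalSpace X] [PolishSpace X]
    [MeasurableSpace X] [BorelSpace X] (hborel : ∀ γ : Γ, Measurable fun x : X => γ • x)
    {S : Finset Γ} {f₀ : X → X × Bool} (hf₀ : f₀.Bijective)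
    (hS : ∀ x, ∃ γ ∈ S, (f₀ x).1 = γ • x) :
    ∃ (T : Finset Γ) (f : X → X × Bool), f.Bijective ∧ (∀ x, ∃ γ ∈ T, (f x).1 = γ • x) ∧
      ∀ γ ∈ T, ∀ k, BaireMeasurableSet {x | f x = (γ • x, k)} := by
  classical
  -- The inverse of `f₀` moves points by `S⁻¹` and its iterate by `S⁻¹ * S⁻¹`; the other terms make
  -- `T` symmetric and let it contain `S`.
  let T : Finset Γ := S ∪ S⁻¹ ∪ (S * S ∪ S⁻¹ * S⁻¹)
  have hTinv : ∀ γ ∈ T, γ⁻¹ ∈ T := fun γ hγ => by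
    have h1 : ∀ δ ∈ S⁻¹, δ⁻¹ ∈ S := fun δ hδ => by simpa using Finset.inv_mem_inv hδ
    simp only [T, Finset.mem_union] at hγ ⊢
    rcases hγ with (hγ | hγ) | hγ | hγ
    · exact Or.inl (Or.inr (Finset.inv_mem_inv hγ))
    · exact Or.inl (Or.inl (h1 γ hγ))
    · obtain ⟨a, ha, b, hb, rfl⟩ := Finset.mem_mul.1 hγ
      rw [mul_inv_rev]
      exact Or.inr (Or.inr (Finset.mul_mem_mul (Finset.inv_mem_inv hb) (Finset.inv_mem_inv ha)))
    · obtain ⟨a, ha, b, hb, rfl⟩ := Finset.mem_mul.1 hγ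
      rw [mul_inv_rev]
      exact Or.inr (Or.inl (Finset.mul_mem_mul (h1 b hb) (h1 a ha)))
  let g : X × Bool → X := (Equiv.ofBijective f₀ hf₀).symm
  have hfg : ∀ p, f₀ (g p) = p := (Equiv.ofBijective f₀ hf₀).apply_symm_apply
  have hg : g.Injective := (Equiv.ofBijective f₀ hf₀).symm.injective
  have hgS : ∀ p, ∃ γ ∈ S⁻¹, g p = γ • p.1 := fun p => by
    obtain ⟨γ, hγ, h⟩ := hS (g p)
    rw [hfg] at h
    exact ⟨γ⁻¹, Finset.inv_mem_inv hγ, by rw [h, inv_smul_smul]⟩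
  have hgT : ∀ p, ∃ γ ∈ T, g p = γ • p.1 := fun p => by
    obtain ⟨γ, hγ, h⟩ := hgS p
    exact ⟨γ, Finset.mem_union_left _ (Finset.mem_union_right _ hγ), h⟩
  have hggT : ∀ x k k', ∃ γ ∈ T, g (g (x, k), k') = γ • x := fun x k k' => by
    obtain ⟨γ, hγ, h⟩ := hgS (x, k)
    obtain ⟨δ, hδ, h'⟩ := hgS (g (x, k), k')
    exact ⟨δ * γ, Finset.mem_union_right _ (Finset.mem_union_right _ (Finset.mul_mem_mul hδ hγ)),
      by rw [h', mul_smul, ← h]⟩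
  have hST : ∀ x, ∃ γ ∈ T, (f₀ x).1 = γ • x := fun x => by
    obtain ⟨γ, hγ, h⟩ := hS x
    exact ⟨γ, Finset.mem_union_left _ (Finset.mem_union_left _ hγ), h⟩
  set e := doublingMap (X := X) T with he
  have hem : ∀ i, Measurable (e i) := measurable_doublingMap hborel
  have hcover := fun n : ℕ => exists_countable_sparse_cover hem (2 ^ (n + 5))
  choose C hCm hCsep hCcov using hcover
  obtain ⟨q, hq⟩ := exists_choice_isMeagre
    (f := fun (z : List (T × Bool) × Fin 3) (x : X) => z.1.foldr e (x, z.2))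
    (fun z => (measurable_foldr hem z.1).comp (measurable_id.prodMk measurable_const)) hCm hCcov
  obtain ⟨m, hm, hmcov⟩ := exists_isPartialMatching (isBipartiteFamily_doublingMap hTinv) hem
    (two_mul_card_le_card_outNbhd_doublingMap hg hgT hggT) (fun n => hCm n (q n))
    fun n => hCsep n (q n)
  -- Asking about every vertex in reach, rather than only those over `x`, makes the exceptional set
  -- invariant under `T`.
  set Z := {x : X | ∃ z : List (T × Bool) × Fin 3, ∀ n, z.1.foldr e (x, z.2) ∉ C n (q n)} with hZ
  have hZ1 : ∀ γ ∈ T, ∀ x, γ • x ∈ Z → x ∈ Z := by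
    rintro γ hγ x ⟨⟨l, j⟩, hz⟩
    -- The appended letter is walked first: it is an edge from a vertex over `x` to `(γ • x, j)`.
    refine ⟨(l ++ [(⟨γ, hγ⟩, decide (j = 1))], if j = 0 then 1 else 0), fun n => ?_⟩
    have := hz n
    fin_cases j <;> simpa [he, doublingMap] using this
  have hZ2 : ∀ γ ∈ T, ∀ x, γ • x ∈ Z ↔ x ∈ Z := fun γ hγ x =>
    ⟨hZ1 γ hγ x, fun hx => hZ1 γ⁻¹ (hTinv γ hγ) _ (by rwa [inv_smul_smul])⟩
  have hmZ : ∀ x ∉ Z, ∀ j, ∃ i, e i (x, j) = m (x, j) := by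
    intro x hx j
    refine (hm.edge (x, j)).resolve_left ?_
    by_contra hfix
    exact hx ⟨([], j), fun n hn => hmcov n _ hn hfix⟩
  -- Both branches move points by elements of `T`, hence preserve `Z` and its complement, so
  -- bijectivity can be checked on each separately.
  let f : X → X × Bool := fun x =>
    if x ∈ Z then f₀ x else ((m (x, 0)).1, decide ((m (x, 0)).2 = 1))
  have hfT : ∀ x, ∃ γ ∈ T, (f x).1 = γ • x := by
    intro x
    by_cases hx : x ∈ Z
    · simpa only [f, if_pos hx] using hST x
    · obtain ⟨i, hi⟩ := hmZ x hx 0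
      simp only [f, if_neg hx, ← hi]
      exact ⟨i.1, i.1.2, rfl⟩
  have hfZ : ∀ x, (f x).1 ∈ Z ↔ x ∈ Z := fun x => by
    obtain ⟨γ, hγ, h⟩ := hfT x
    rw [h]
    exact hZ2 γ hγ x
  refine ⟨T, f, ⟨fun x x' hxx' => ?_, fun ⟨y, k⟩ => ?_⟩, hfT, fun γ _ k => ?_⟩
  · by_cases hx : x ∈ Z
    · have hx' : x' ∈ Z := by rwa [← hfZ, ← hxx', hfZ]
      simp only [f, if_pos hx, if_pos hx'] at hxx'
      exact hf₀.1 hxx'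
    · have hx' : x' ∉ Z := by rwa [← hfZ, ← hxx', hfZ]
      simp only [f, if_neg hx, if_neg hx', Prod.mk.injEq, decide_eq_decide] at hxx'
      have hmm : m (x, 0) = m (x', 0) := by
        refine Prod.ext hxx'.1 ?_
        have h3 := hxx'.2
        obtain ⟨⟨γ, b⟩, hi⟩ := hmZ x hx 0
        obtain ⟨⟨γ', b'⟩, hi'⟩ := hmZ x' hx' 0
        rw [← hi, ← hi'] at h3 ⊢
        cases b <;> cases b' <;> simp [he, doublingMap] at h3 ⊢
      have := congrArg m hmm
      rw [hm.invol, hm.invol] at this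
      exact congrArg Prod.fst this
  · by_cases hy : y ∈ Z
    · refine ⟨g (y, k), ?_⟩
      have hx : g (y, k) ∈ Z := by
        obtain ⟨γ, hγ, h⟩ := hgT (y, k)
        rw [h]
        exact (hZ2 γ hγ y).2 hy
      simp only [f, if_pos hx, hfg]
    · obtain ⟨i, hi⟩ := hmZ y hy (if k then 1 else 2)
      have hmy : m (y, if k then 1 else 2) = (i.1.1 • y, 0) := by
        rw [← hi]
        cases k <;> simp [he, doublingMap]
      have hx : i.1.1 • y ∉ Z := by rwa [hZ2 _ i.1.2]
      refine ⟨i.1.1 • y, ?_⟩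
      simp only [f, if_neg hx]
      rw [← hmy, hm.invol]
      cases k <;> simp
  · have hmeas : MeasurableSet {x : X | (m (x, 0)).1 = γ • x ∧ decide ((m (x, 0)).2 = 1) = k} := by
      have h0 : Measurable fun x : X => m (x, 0) :=
        hm.measurable.comp (measurable_id.prodMk measurable_const)
      exact measurableSet_setOfPred.2
        (((measurable_fst.comp h0).eq_of_countablySeparated (hborel γ)).and
          ((measurable_of_finite fun j : Fin 3 => decide (j = 1) = k).comp
            (measurable_snd.comp h0)))
    refine hmeas.baireMeasurableSet.congr ?_
    filter_upwards [hq] with x hx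
    have hx' : x ∉ Z := hx
    refine propext ?_
    change _ ↔ f x = (γ • x, k)
    simp only [f, if_neg hx', Prod.mk.injEq]
    rfl

end Paradox

theorem theorem1p1 {Γ X : Type*} [Group Γ] [MulAction Γ X]
    [TopologicalSpace X] [PolishSpace X] [MeasurableSpace X] [BorelSpace X]
    (hborel : ∀ γ : Γ, Measurable (fun x : X => γ • x))
    (hparadox : ∃ (n m : ℕ) (A : Fin n → Set X) (B : Fin m → Set X),
      IsParadoxicalDecomposition Γ A B) :
    ∃ (n m : ℕ) (A : Fin n → Set X) (B : Fin m → Set X),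
      IsParadoxicalDecomposition Γ A B ∧
      (∀ i, BaireMeasurableSet (A i)) ∧ (∀ j, BaireMeasurableSet (B j)) := by
  obtain ⟨n, m, A, B, h⟩ := hparadox
  obtain ⟨S, f₀, hf₀, hS⟩ := h.exists_bijective
  obtain ⟨T, f, hf, hT, hm⟩ := exists_bijective_baireMeasurableSet hborel hf₀ hS
  exact exists_isParadoxicalDecomposition_of_bijective hf hT hm
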